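/- Let $\mathbb{H}[q_1,q_2]$ be the ring of slice regular polynomials $P(q_1,q_2)=\sum_{n,m} q_1^n q_2^m a_{n,m}$ with $a_{n,m}\in\mathbb{H}$ (finite sums), with the $*$-product determined by additivity and $(q_1^nq_2^ma)*(q_1^rq_2^sb)=q_1^{n+r}q_2^{m+s}ab$; let $\mathbb{H}[q_1],\mathbb{H}[q_2]\subset\mathbb{H}[q_1,q_2]$ be the subrings of polynomials in one variable, and for $P,Q\in\mathbb{H}[q_1,q_2]$ let $\langle P,Q\rangle=\{P*R+Q*S : R,S\in\mathbb{H}[q_1,q_2]\}$ be the right ideal they generate. For a skew field $F$ write $[x]$ for the class of $x\in F$ in $\overline F=\{[0]\}\cup F^\times/[F^\times,F^\times]$. The Dieudonné determinant $\mathrm{Det}_N$ of $N\times N$ matrices over $F$ is the homomorphism $GL(N,F)\to F^\times/[F^\times,F^\times]$ with $\mathrm{Det}_N(\mathrm{diag}(\lambda_1,\dots,\lambda_N))=[\lambda_1\cdots\lambda_N]$, extended by $[0]$ to non-invertible matrices. Let $\mathbb{H}(q_i)$ be the skew field of quotients of the Ore domain $(\mathbb{H}[q_i],+,*)$. Write $P=\sum_{k=0}^{n}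 q_1^k*P_k(q_2)$ and $Q=\sum_{k=0}^{m} q_1^k*Q_k(q_2)$ with $n=\deg_{q_1}P$, $m=\deg_{q_1}Q$ (the zero polynomial being given degree $0$), and set $P_k=0$ for $k\notin\{0,\dots,n\}$ and $Q_k=0$ for $k\notin\{0,\dots,m\}$. If $n+m\ge 1$, let $A(q_2)$ be the $(n+m)\times(n+m)$ Sylvester matrix whose entry in row $i$ and column $j$ ($0\le i,j<n+m$) is $P_{i-j}$ if $j<m$ and $Q_{i-(j-m)}$ if $j\ge m$, and let $\mathrm{Res}(P,Q;q_1)=\mathrm{Det}_{n+m}(A(q_2))\in\overline{\mathbb{H}(q_2)}$. If $\deg_{q_2}P+\deg_{q_2}Q\ge1$, let $\mathrm{Res}(P,Q;q_2)\in\overline{\mathbb{H}(q_1)}$ be defined in the same way with the roles of the two variables exchanged, from $P=\sum_k q_2^k*\tilde P_k(q_1)$ and $Q=\sum_k q_2^k*\tilde Q_k(q_1)$. **Theorem.** Let $P,Q\in\mathbb{H}[q_1,q_2]$. 1. If $\deg_{q_1}P+\deg_{q_1}Q\ge 1$, then $\mathrm{Res}(P,Q;q_1)$ has a representative in $\langle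 P,Q\rangle\cap\mathbb{H}[q_2]$: there is $R\in\mathbb{H}[q_2]\cap\langle P,Q\rangle$ with $\mathrm{Res}(P,Q;q_1)=[R]$. 2. If $\deg_{q_2}P+\deg_{q_2}Q\ge 1$, then $\mathrm{Res}(P,Q;q_2)$ has a representative in $\langle P,Q\rangle\cap\mathbb{H}[q_1]$: there is $R\in\mathbb{H}[q_1]\cap\langle P,Q\rangle$ with $\mathrm{Res}(P,Q;q_2)=[R]$. -/

import Mathlib

open Polynomial
open scoped Quaternion nonZeroDivisors

noncomputable section

namespace SliceRegular

/-! ### Slice regular polynomials -/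

/-- Slice regular polynomials `∑ qⁿ aₙ` in one quaternionic variable, given by their coefficients.
The variable is central in the ring `ℍ[ℝ][X]`, so that its product is the `*`-product
`(f * g)ₙ = ∑ₖ aₖ b₍ₙ₋ₖ₎`. -/
abbrev Poly1 : Type := ℍ[ℝ][X]

/-- The ring `ℍ[q₁, q₂]` of slice regular polynomials `P = ∑ q₁ⁿ q₂ᵐ aₙₘ` in two quaternionic
variables with the `*`-product, written as `P = ∑ q₁ⁿ Pₙ(q₂)`: the outer variable is `q₁`, the
inner variable is `q₂`, and `aₙₘ = (P.coeff n).coeff m`. Both variables are central for `*`. -/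
abbrev Poly2 : Type := ℍ[ℝ][X][X]

/-- The function `q ↦ ∑ qᵐ aₘ` of a slice regular polynomial in one variable. -/
def toFun1 (f : Poly1) (q : ℍ[ℝ]) : ℍ[ℝ] :=
  f.sum fun m a => q ^ m * a

/-- The function `(q₁, q₂) ↦ ∑ q₁ⁿ q₂ᵐ aₙₘ` of a slice regular polynomial in two variables. -/
def toFun2 (P : Poly2) (q₁ q₂ : ℍ[ℝ]) : ℍ[ℝ] :=
  P.sum fun n Pn => q₁ ^ n * toFun1 Pn q₂

theorem toFun1_zero (q : ℍ[ℝ]) : toFun1 0 q = 0 := by simp [toFun1]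

theorem toFun1_sub (f g : Poly1) (q : ℍ[ℝ]) : toFun1 (f - g) q = toFun1 f q - toFun1 g q := by
  rw [eq_sub_iff_add_eq, toFun1, toFun1,
    ← Polynomial.sum_add_index _ _ _ (by simp) (fun _ _ _ => mul_add _ _ _), sub_add_cancel]
  rfl

theorem toFun2_sub (P Q : Poly2) (q₁ q₂ : ℍ[ℝ]) :
    toFun2 (P - Q) q₁ q₂ = toFun2 P q₁ q₂ - toFun2 Q q₁ q₂ := by
  have hadd : ∀ f g : Poly1, toFun1 (f + g) q₂ = toFun1 f q₂ + toFun1 g q₂ := fun f g => by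
    rw [← sub_eq_iff_eq_add, ← toFun1_sub, add_sub_cancel_right]
  rw [eq_sub_iff_add_eq, toFun2, toFun2, ← Polynomial.sum_add_index _ _ _
    (by simp [toFun1_zero]) (fun _ _ _ => by rw [hadd, mul_add]), sub_add_cancel]
  rfl

theorem eq_zero_of_toFun1 (f : Poly1) (h : ∀ x : ℝ, toFun1 f x = 0) : f = 0 := by
  have key : ∀ c : ℍ[ℝ] →ₗ[ℝ] ℝ, ∀ m, c (f.coeff m) = 0 := by
    intro c m
    have hz : (∑ m ∈ f.support, Polynomial.monomial m (c (f.coeff m)) : ℝ[X]) = 0 := by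
      refine Polynomial.funext fun x => ?_
      have := congrArg c (h x)
      rw [toFun1, Polynomial.sum, map_sum, map_zero] at this
      rw [Polynomial.eval_finsetSum, Polynomial.eval_zero, ← this]
      refine Finset.sum_congr rfl fun m _ => ?_
      rw [← Quaternion.coe_pow, Quaternion.coe_mul_eq_smul, map_smul, Polynomial.eval_monomial,
        smul_eq_mul, mul_comm]
    have := congrArg (fun p => Polynomial.coeff p m) hz
    simp only [Polynomial.finsetSum_coeff, Polynomial.coeff_monomial, Finset.sum_ite_eq',
      Polynomial.coeff_zero] at this
    by_cases hm : m ∈ f.support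
    · simpa [hm] using this
    · simp [Polynomial.notMem_support_iff.1 hm]
  ext m
  · exact key (QuaternionAlgebra.reₗ _ _ _) m
  · exact key (QuaternionAlgebra.imIₗ _ _ _) m
  · exact key (QuaternionAlgebra.imJₗ _ _ _) m
  · exact key (QuaternionAlgebra.imKₗ _ _ _) m

/-- A slice regular polynomial function of one variable determines its coefficients. -/
theorem toFun1_injective : Function.Injective toFun1 := fun f g h =>
  sub_eq_zero.1 <| eq_zero_of_toFun1 _ fun x => by rw [toFun1_sub, h, sub_self]

/-- A slice regular polynomial function of two variables determines its coefficients, so that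
`Poly2` is indeed a ring of functions on `ℍ²`. -/
theorem toFun2_injective : Function.Injective toFun2 := by
  intro P Q h
  rw [← sub_eq_zero]
  have h0 : ∀ x y : ℝ, toFun2 (P - Q) x y = 0 := fun x y => by rw [toFun2_sub, h, sub_self]
  generalize P - Q = S at h0
  ext1 n
  rw [Polynomial.coeff_zero]
  refine eq_zero_of_toFun1 _ fun y => ?_
  have hz : (∑ n ∈ S.support, Polynomial.monomial n (toFun1 (S.coeff n) y) : Poly1) = 0 := by
    refine eq_zero_of_toFun1 _ fun x => ?_
    rw [← h0 x y, toFun2, Polynomial.sum]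
    have hadd : ∀ t : Finset ℕ,
        toFun1 (∑ n ∈ t, Polynomial.monomial n (toFun1 (S.coeff n) y)) x
          = ∑ n ∈ t, (x : ℍ[ℝ]) ^ n * toFun1 (S.coeff n) y := by
      intro t
      classical
      induction t using Finset.induction_on with
      | empty => simp [toFun1_zero]
      | insert a t ha ih =>
        rw [Finset.sum_insert ha, Finset.sum_insert ha, ← ih, toFun1,
          Polynomial.sum_add_index _ _ _ (by simp) (fun _ _ _ => mul_add _ _ _),
          Polynomial.sum_monomial_index _ _ (by simp)]
        rfl
    exact hadd _
  have := congrArg (fun p => Polynomial.coeff p n) hz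
  simp only [Polynomial.finsetSum_coeff, Polynomial.coeff_monomial, Finset.sum_ite_eq',
    Polynomial.coeff_zero] at this
  by_cases hn : n ∈ S.support
  · simpa [hn] using this
  · rw [Polynomial.notMem_support_iff.1 hn, toFun1_zero]

/-- Exchange of the roles of the two variables: if `P = ∑ q₁ⁿ q₂ᵐ aₙₘ`, then
`swap P = ∑ₘ q₂ᵐ * P̃ₘ(q₁)`, the outer variable now being `q₂`, and `P̃ₘ = ∑ₙ q₁ⁿ aₙₘ`. -/
def swap (P : Poly2) : ℍ[ℝ][X][X] :=
  P.sum fun n Pn => Pn.sum fun m a => monomial m (monomial n a)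

theorem coeff_coeff_swap (P : Poly2) (m n : ℕ) :
    ((swap P).coeff m).coeff n = (P.coeff n).coeff m := by
  have h1 : ∀ (k : ℕ) (f : Poly1),
      (((f.sum fun m a => monomial m (monomial k a)) : ℍ[ℝ][X][X]).coeff m).coeff n
        = if k = n then f.coeff m else 0 := by
    intro k f
    simp only [Polynomial.sum, Polynomial.finsetSum_coeff, Polynomial.coeff_monomial,
      apply_ite (fun p : Poly1 => p.coeff n), Polynomial.coeff_zero]
    rw [Finset.sum_ite_eq']
    by_cases hm : m ∈ f.support
    · simp [hm]
    · simp [hm, Polynomial.notMem_support_iff.1 hm]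
  rw [swap, Polynomial.sum, Polynomial.finsetSum_coeff, Polynomial.finsetSum_coeff]
  simp only [h1]
  rw [Finset.sum_ite_eq']
  by_cases hn : n ∈ P.support
  · simp [hn]
  · simp [hn, Polynomial.notMem_support_iff.1 hn]

/-- The degree of `P` in `q₁`. -/
def degQ1 (P : Poly2) : ℕ := P.natDegree

/-- The degree of `P` in `q₂`. -/
def degQ2 (P : Poly2) : ℕ := (swap P).natDegree

/-- The inclusion `ℍ[q₁] ⊆ ℍ[q₁, q₂]`. -/
def ofQ1 : Poly1 →+* Poly2 := Polynomial.mapRingHom Polynomial.C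

/-- The inclusion `ℍ[q₂] ⊆ ℍ[q₁, q₂]`. -/
def ofQ2 : Poly1 →+* Poly2 := Polynomial.C

/-- The right ideal `⟨P, Q⟩` of `ℍ[q₁, q₂]`. -/
def rightIdeal (P Q : Poly2) : Set Poly2 :=
  {T | ∃ R S : Poly2, T = P * R + Q * S}

/-! ### The skew field of quotients of `ℍ[q]` -/

/-- The regular conjugate `∑ qⁿ āₙ` of `∑ qⁿ aₙ`, an anti-automorphism of `ℍ[q]`. -/
def conjHom : Poly1 →+* Poly1ᵐᵒᵖ :=
  ((Polynomial.opRingEquiv ℍ[ℝ]).symm : ℍ[ℝ]ᵐᵒᵖ[X] →+* Poly1ᵐᵒᵖ).comp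
    (Polynomial.mapRingHom (starRingEquiv : ℍ[ℝ] ≃+* ℍ[ℝ]ᵐᵒᵖ))

/-- The regular conjugate of a slice regular polynomial in one variable. -/
def conj (f : Poly1) : Poly1 := (conjHom f).unop

theorem coeff_conj (f : Poly1) (n : ℕ) : (conj f).coeff n = star (f.coeff n) := by
  have h := Polynomial.coeff_opRingEquiv (conjHom f) n
  have h' : Polynomial.opRingEquiv ℍ[ℝ] (conjHom f)
      = f.map ((starRingEquiv : ℍ[ℝ] ≃+* ℍ[ℝ]ᵐᵒᵖ) : ℍ[ℝ] →+* ℍ[ℝ]ᵐᵒᵖ) := by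
    simp [conjHom]
  rw [h', Polynomial.coeff_map] at h
  exact (MulOpposite.op_injective h).symm

theorem conj_mul (f g : Poly1) : conj (f * g) = conj g * conj f := by
  simp [conj]

theorem conj_conj (f : Poly1) : conj (conj f) = f := by
  ext1 n; rw [coeff_conj, coeff_conj, star_star]

theorem conj_ne_zero {f : Poly1} (hf : f ≠ 0) : conj f ≠ 0 := by
  intro h
  apply hf
  ext1 n
  rw [← star_star (f.coeff n), ← coeff_conj, h]
  simp

/-- The symmetrization `conj f * f` has real coefficients, hence is central. -/
theorem conj_mul_self_comm (f g : Poly1) : conj f * f * g = g * (conj f * f) := by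
  have hs : conj (conj f * f) = conj f * f := by rw [conj_mul, conj_conj]
  have hr : ∀ (n : ℕ) (a : ℍ[ℝ]), (conj f * f).coeff n * a = a * (conj f * f).coeff n := by
    intro n a
    have : star ((conj f * f).coeff n) = (conj f * f).coeff n := by rw [← coeff_conj, hs]
    rw [Quaternion.star_eq_self.1 this]
    exact Quaternion.coe_commutes _ _
  ext1 n
  rw [Polynomial.coeff_mul, Polynomial.coeff_mul,
    ← Finset.Nat.sum_antidiagonal_swap]
  exact Finset.sum_congr rfl fun p _ => hr _ _

/-- `ℍ[q]` is an Ore domain. -/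
instance : OreLocalization.OreSet Poly1⁰ :=
  OreLocalization.oreSetOfNoZeroDivisors
    (fun r s => r * conj s.1)
    (fun _ s => ⟨conj s.1 * s.1, mem_nonZeroDivisors_of_ne_zero
      (mul_ne_zero (conj_ne_zero (nonZeroDivisors.ne_zero s.2)) (nonZeroDivisors.ne_zero s.2))⟩)
    (fun r s => by
      change conj s.1 * s.1 * r = r * conj s.1 * s.1
      rw [conj_mul_self_comm, mul_assoc])

/-- The skew field of quotients `ℍ(q)` of the Ore domain `ℍ[q]`. -/
abbrev QuotField : Type := OreLocalization Poly1⁰ Poly1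

/-- The inclusion `ℍ[q] ⊆ ℍ(q)`. -/
def toQuot : Poly1 →+* QuotField := OreLocalization.numeratorRingHom

end SliceRegular

/-! ### Dieudonné determinants -/

namespace Dieudonne

variable {F : Type*} [DivisionRing F]

/-- The values of the determinant: the abelianization of `Fˣ` with the class of `0` added. -/
abbrev Values (F : Type*) [DivisionRing F] : Type _ := WithZero (Abelianization Fˣ)

open Classical in
/-- The class `[x]` of `x ∈ F`. -/
def cls (x : F) : Values F :=
  if h : x = 0 then 0 else (Abelianization.of (Units.mk0 x h) : Abelianization Fˣ)

/-- The property that characterizes the Dieudonné determinant among the homomorphisms from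
`GL(n, F)` to the abelianization of `Fˣ`: a diagonal matrix is sent to the class of the product
of its diagonal entries. -/
def IsDet {n : ℕ} (f : GL (Fin n) F →* Abelianization Fˣ) : Prop :=
  ∀ (u : GL (Fin n) F) (d : Fin n → Fˣ),
    (u : Matrix (Fin n) (Fin n) F) = Matrix.diagonal (fun i => (d i : F)) →
      f u = Abelianization.of (List.ofFn d).prod

/-- The Dieudonné determinant on `GL(n, F)`: the homomorphism with the property `IsDet`, which
exists for every `n` and every skew field `F`. -/
def detGL (n : ℕ) (F : Type*) [DivisionRing F] : GL (Fin n) F →* Abelianization Fˣ :=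
  Classical.epsilon IsDet

open Classical in
/-- The Dieudonné determinant of a square matrix, with the value `[0]` on non-invertible
matrices. -/
def det {n : ℕ} (A : Matrix (Fin n) (Fin n) F) : Values F :=
  if h : IsUnit A then (detGL n F h.unit : Abelianization Fˣ) else 0

end Dieudonne

/-! ### Regular resultants -/

namespace SliceRegular

/-- The regular resultant of `P` and `Q` with respect to `q₁`: the Dieudonné determinant of the
Sylvester matrix with entries in `ℍ[q₂]`, of size `deg_{q₁} P + deg_{q₁} Q`, the first
`deg_{q₁} Q` columns of which hold the shifted coefficients `Pₙ(q₂)` of `P` and the last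
`deg_{q₁} P` columns those of `Q`. -/
def resQ1 (P Q : Poly2) : Dieudonne.Values QuotField :=
  Dieudonne.det ((Polynomial.sylvester Q P (degQ1 Q) (degQ1 P)).map toQuot)

/-- The regular resultant of `P` and `Q` with respect to `q₂`: the Dieudonné determinant of the
Sylvester matrix of `P = ∑ q₂ᵐ * P̃ₘ(q₁)` and `Q = ∑ q₂ᵐ * Q̃ₘ(q₁)`, with entries in `ℍ[q₁]`. -/
def resQ2 (P Q : Poly2) : Dieudonne.Values QuotField :=
  Dieudonne.det ((Polynomial.sylvester (swap Q) (swap P) (degQ2 Q) (degQ2 P)).map toQuot)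

end SliceRegular

end

/-!
The columns of the Sylvester matrix `A` are the coefficient vectors, with respect to the outer
variable, of the polynomials `P * q₁ʲ` and `Q * q₁ʲ`. Hence, if `A v = (R, 0, …, 0)` for a vector
`v` over the coefficient ring `ℍ[q]`, then `R` lies in the right ideal `⟨P, Q⟩`. As `ℍ[q]` has a
division with remainder, column operations bring `A` to an upper triangular form `A U`
(`Matrix.exists_mul_mem_elementary_upperTriangular`). Its first column is `(t₀, 0, …, 0)`, so the
product `R = t₀ t₁ ⋯` of the diagonal entries lies in the ideal, and it represents the determinant
of `A` because elementary matrices are commutators in the general linear group and so have trivial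
determinant (`SliceRegular.exists_det_eq_and_mulVec_eq`). The statement on the other variable
follows by exchanging the two variables, which is an involutive ring automorphism.

The Dieudonné determinant is defined by a choice among the homomorphisms with the right values on
diagonal matrices, so one such homomorphism has to be constructed. Over `ℍ(q)` this is done with
the reduced norm. The representation of quaternions by complex matrices of size two embeds `ℍ(q)`
into the matrices of size two over the rational functions, and so turns a square matrix over `ℍ(q)`
into a larger one over a commutative field, whose determinant is the reduced norm of the matrix. By
triangularization it takes on `GL(N, ℍ(q))` only values that it takes on `ℍ(q)ˣ`. Elements of `ℍ(q)`
of reduced norm `1` are products of commutators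
(`SliceRegular.of_eq_one_of_redNorm_eq_one`, by Hilbert's Theorem 90), so the reduced norm is
injective on the abelianization of `ℍ(q)ˣ`, and composing the reduced norm of matrices with the
inverse of this injection gives the determinant (`SliceRegular.isDet_detGL`).
-/

noncomputable section

/-! ### Elementary matrices over a ring with division -/

namespace Matrix

section Elementary

variable {n : Type*} [Fintype n] [DecidableEq n]

/-- The monoid of products of the elementary matrices `1 + c Eᵢⱼ` with `i ≠ j`, over a ring that
need not be commutative. -/
def elementary (n R : Type*) [Fintype n] [DecidableEq n] [Ring R] : Submonoid (Matrix n n R) :=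
  Submonoid.closure {U | ∃ (i j : n) (c : R), i ≠ j ∧ U = 1 + single i j c}

theorem one_add_single_mem_elementary {R : Type*} [Ring R] {i j : n} (h : i ≠ j) (c : R) :
    1 + single i j c ∈ elementary n R :=
  Submonoid.subset_closure ⟨i, j, c, h, rfl⟩

theorem one_add_single_mul_one_add_single {R : Type*} [Ring R] {i j : n} (h : i ≠ j) (c d : R) :
    (1 + single i j c) * (1 + single i j d) = 1 + single i j (c + d) := by
  simp only [Matrix.add_mul, Matrix.mul_add, Matrix.one_mul, Matrix.mul_one, single_add,
    single_mul_single_of_ne _ _ _ _ h.symm]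
  abel

/-- The elementary matrix `1 + c Eᵢⱼ` as an element of the general linear group. -/
def elementaryUnit {R : Type*} [Ring R] {i j : n} (h : i ≠ j) (c : R) : GL n R where
  val := 1 + single i j c
  inv := 1 + single i j (-c)
  val_inv := by simp [one_add_single_mul_one_add_single h]
  inv_val := by simp [one_add_single_mul_one_add_single h]

theorem isUnit_of_mem_elementary {R : Type*} [Ring R] {U : Matrix n n R}
    (hU : U ∈ elementary n R) : IsUnit U := by
  induction hU using Submonoid.closure_induction with
  | mem U h => obtain ⟨i, j, c, h, rfl⟩ := h; exact ⟨elementaryUnit h c, rfl⟩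
  | one => exact isUnit_one
  | mul U V _ _ hU hV => exact hU.mul hV

theorem map_mem_elementary {R S : Type*} [Ring R] [Ring S] (φ : R →+* S) {U : Matrix n n R}
    (hU : U ∈ elementary n R) : U.map φ ∈ elementary n S := by
  induction hU using Submonoid.closure_induction with
  | mem U h =>
    obtain ⟨i, j, c, h, rfl⟩ := h
    rw [Matrix.map_add φ (map_add φ), Matrix.map_one φ (map_zero φ) (map_one φ), map_single]
    exact one_add_single_mem_elementary h _
  | one =>
    rw [Matrix.map_one φ (map_zero φ) (map_one φ)]
    exact one_mem _
  | mul U V _ _ hU hV =>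
    rw [Matrix.map_mul]
    exact mul_mem hU hV

theorem mul_one_add_single_apply {R : Type*} [Ring R] (A : Matrix n n R) (i j : n) (c : R)
    (a b : n) :
    (A * (1 + single i j c)) a b = A a b + if b = j then A a i * c else 0 := by
  rw [Matrix.mul_add, Matrix.mul_one, add_apply]
  split_ifs with h
  · subst h; simp
  · simp [h]

theorem one_add_single_mul_apply {R : Type*} [Ring R] (A : Matrix n n R) (i j : n) (c : R)
    (a b : n) :
    ((1 + single i j c) * A) a b = A a b + if a = i then c * A j b else 0 := by
  rw [Matrix.add_mul, Matrix.one_mul, add_apply]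
  split_ifs with h
  · subst h; simp
  · simp [h]

/-- A homomorphism from the general linear group of a skew field with more than two elements to a
commutative group is trivial on products of elementary matrices, because `1 + c Eᵢⱼ` is a
commutator: conjugation by a diagonal matrix takes `1 + c Eᵢⱼ` to `1 + a c Eᵢⱼ`, and the quotient
of the two is `1 + (a - 1) c Eᵢⱼ`. -/
theorem hom_eq_one_of_mem_elementary {F G : Type*} [DivisionRing F] [CommGroup G] {a : F}
    (ha0 : a ≠ 0) (ha1 : a ≠ 1) (f : GL n F →* G) {u : GL n F}
    (hu : (u : Matrix n n F) ∈ elementary n F) : f u = 1 := by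
  have key : ∀ {i j : n} (h : i ≠ j) (c : F), f (elementaryUnit h c) = 1 := by
    intro i j h c
    have hd : ∀ b b' : F, b * b' = 1 →
        diagonal (Function.update (1 : n → F) i b) * diagonal (Function.update 1 i b') = 1 := by
      intro b b' hb
      rw [diagonal_mul_diagonal, ← diagonal_one]
      congr 1; ext k
      by_cases hk : k = i
      · subst hk; simp [hb]
      · simp [hk]
    let D : GL n F :=
      ⟨diagonal (Function.update 1 i a), diagonal (Function.update 1 i a⁻¹),
        hd _ _ (mul_inv_cancel₀ ha0), hd _ _ (inv_mul_cancel₀ ha0)⟩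
    have h1 : ∀ d : F, D * elementaryUnit h d = elementaryUnit h (a * d) * D := by
      intro d
      ext k l
      change (diagonal (Function.update (1 : n → F) i a) * (1 + single i j d)) k l
        = ((1 + single i j (a * d)) * diagonal (Function.update (1 : n → F) i a)) k l
      rw [mul_one_add_single_apply, one_add_single_mul_apply, diagonal_apply, diagonal_apply,
        diagonal_apply]
      by_cases hk : k = i <;> by_cases hl : l = j <;> subst_vars <;> simp_all [eq_comm]
    have h2 : ∀ d : F, f (elementaryUnit h (a * d)) = f (elementaryUnit h d) := by
      intro d
      have := congrArg f (h1 d)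
      rw [map_mul, map_mul, mul_comm] at this
      exact (mul_right_cancel this).symm
    have h3 : ∀ d e : F, elementaryUnit h d * elementaryUnit h e = elementaryUnit h (d + e) :=
      fun d e => Units.ext (one_add_single_mul_one_add_single h d e)
    have h4 := h2 ((a - 1)⁻¹ * c)
    have h5 : a * ((a - 1)⁻¹ * c) = c + (a - 1)⁻¹ * c := by
      have : (a - 1) * ((a - 1)⁻¹ * c) = c := mul_inv_cancel_left₀ (sub_ne_zero.2 ha1) c
      rw [sub_mul, one_mul, sub_eq_iff_eq_add] at this
      exact this
    rw [h5, ← h3, map_mul] at h4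
    exact mul_eq_right.1 h4
  have : ∀ U ∈ elementary n F, ∀ u : GL n F, (u : Matrix n n F) = U → f u = 1 := by
    intro U hU
    induction hU using Submonoid.closure_induction with
    | mem U h =>
      obtain ⟨i, j, c, h, rfl⟩ := h
      intro u hu
      rw [← key h c]
      exact congrArg f (Units.ext hu)
    | one =>
      intro u hu
      rw [← map_one f]
      exact congrArg f (Units.ext hu)
    | mul U V hU' hV' hU hV =>
      intro u hu
      obtain ⟨x, rfl⟩ := isUnit_of_mem_elementary hU'
      obtain ⟨y, rfl⟩ := isUnit_of_mem_elementary hV'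
      rw [show u = x * y from Units.ext hu, map_mul, hU x rfl, hV y rfl, one_mul]
  exact this _ hu u rfl

/-- Euclid's algorithm on columns: over a ring with division with remainder, every square matrix
becomes upper triangular when it is multiplied by a suitable product of elementary matrices on
the right. -/
theorem exists_mul_mem_elementary_upperTriangular {R : Type*} [Ring R] {N : ℕ} (δ : R → ℕ)
    (hδ0 : δ 0 = 0) (hδ : ∀ a b : R, b ≠ 0 → ∃ x, δ (a - b * x) < δ b)
    (A : Matrix (Fin N) (Fin N) R) :
    ∃ U ∈ elementary (Fin N) R, ∀ i j : Fin N, j < i → (A * U) i j = 0 := by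
  -- The rows are cleared from the last one upwards.
  suffices h : ∀ k ≤ N, ∃ U ∈ elementary (Fin N) R,
      ∀ i j : Fin N, N - k ≤ i → j < i → (A * U) i j = 0 by
    obtain ⟨U, hU, h⟩ := h N le_rfl
    exact ⟨U, hU, fun i j hij => h i j (by simp) hij⟩
  intro k
  induction k with
  | zero => exact fun _ => ⟨1, one_mem _, fun i j hi => absurd i.2 (by lia)⟩
  | succ k ih =>
    intro hk
    obtain ⟨U₀, hU₀, h₀⟩ := ih (by lia)
    let r : Fin N := ⟨N - (k + 1), by lia⟩
    have hr : ∀ i : Fin N, N - k ≤ i ↔ r < i := fun i => by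
      rw [Fin.lt_def]; change _ ↔ N - (k + 1) < _; lia
    have hr' : ∀ i : Fin N, N - (k + 1) ≤ i ↔ i = r ∨ r < i := fun i => by
      rw [Fin.lt_def, Fin.ext_iff]; change _ ↔ _ = N - (k + 1) ∨ N - (k + 1) < _; lia
    simp only [hr] at h₀
    simp only [hr']
    -- The weight `2` makes the measure drop when an entry is moved to the diagonal.
    let μ : Matrix (Fin N) (Fin N) R → ℕ := fun B =>
      ∑ j, (if j < r then 2 else if j = r then 1 else 0) * δ (B r j)
    suffices h : ∀ (m : ℕ) (B : Matrix (Fin N) (Fin N) R), μ B = m →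
        (∀ i j : Fin N, r < i → j < i → B i j = 0) →
        ∃ U ∈ elementary (Fin N) R, ∀ i j : Fin N, i = r ∨ r < i → j < i → (B * U) i j = 0 by
      obtain ⟨U, hU, h⟩ := h _ _ rfl h₀
      exact ⟨U₀ * U, mul_mem hU₀ hU, by rwa [← Matrix.mul_assoc]⟩
    intro m
    induction m using Nat.strong_induction_on with
    | _ m ihm =>
      intro B hm hB
      have hpos : ∀ b : R, b ≠ 0 → 0 < δ b := fun b hb =>
        let ⟨x, hx⟩ := hδ 0 b hb; (Nat.zero_le _).trans_lt hx
      by_cases hz : ∀ j < r, B r j = 0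
      · refine ⟨1, one_mem _, fun i j hi hj => ?_⟩
        rw [Matrix.mul_one]
        rcases hi with rfl | hi
        · exact hz j hj
        · exact hB i j hi hj
      push Not at hz
      obtain ⟨j, hj, hBj⟩ := hz
      -- A column operation among the columns up to `r` keeps the rows below `r`.
      have keep : ∀ (C : Matrix (Fin N) (Fin N) R) (a b : Fin N) (c : R), a ≤ r → b ≤ r →
          (∀ i j : Fin N, r < i → j < i → C i j = 0) →
          ∀ i j : Fin N, r < i → j < i → (C * (1 + single a b c)) i j = 0 := by
        intro C a b c ha hb hC i l hi hl
        rw [mul_one_add_single_apply, hC i l hi hl, hC i a hi (ha.trans_lt hi)]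
        simp
      have step : ∀ U ∈ elementary (Fin N) R,
          (∀ i j : Fin N, r < i → j < i → (B * U) i j = 0) → μ (B * U) < m →
          ∃ U ∈ elementary (Fin N) R, ∀ i j : Fin N, i = r ∨ r < i → j < i → (B * U) i j = 0 := by
        intro U hU hBU hlt
        obtain ⟨V, hV, h⟩ := ihm _ hlt (B * U) rfl hBU
        exact ⟨U * V, mul_mem hU hV, by rwa [← Matrix.mul_assoc]⟩
      by_cases hd : B r r = 0
      · have hjr := hj.ne
        let V : Matrix (Fin N) (Fin N) R := (1 + single j r 1) * (1 + single r j (-1))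
        refine step V
          (mul_mem (one_add_single_mem_elementary hjr _)
            (one_add_single_mem_elementary hjr.symm _)) ?_ ?_
        · rw [show B * V = _ from (Matrix.mul_assoc _ _ _).symm]
          exact keep _ _ _ _ le_rfl hj.le (keep _ _ _ _ hj.le le_rfl hB)
        · have e : ∀ l, (B * V) r l
              = if l = r then B r j else if l = j then 0 else B r l := by
            intro l
            rw [show B * V = _ from (Matrix.mul_assoc _ _ _).symm, mul_one_add_single_apply,
              mul_one_add_single_apply,
              mul_one_add_single_apply]
            by_cases hl : l = r
            · subst hl; simp [hd, hjr.symm]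
            · by_cases hl' : l = j
              · subst hl'; simp [hd, hl]
              · simp [hl, hl']
          rw [← hm]
          change ∑ l, _ < ∑ l, _
          have s : ∀ g : Fin N → ℕ,
              ∑ l, g l = g j + (g r + ∑ l ∈ (Finset.univ.erase j).erase r, g l) := by
            intro g
            rw [Finset.add_sum_erase _ _ (by simp [hjr.symm]), Finset.add_sum_erase _ _ (by simp)]
          rw [s, s]
          have : ∑ l ∈ (Finset.univ.erase j).erase r, (if l < r then 2 else if l = r then 1 else 0) *
              δ ((B * V) r l)
              = ∑ l ∈ (Finset.univ.erase j).erase r, (if l < r then 2 else if l = r then 1 else 0) *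
              δ (B r l) := by
            refine Finset.sum_congr rfl fun l hl => ?_
            simp only [Finset.mem_erase] at hl
            simp only [e, if_neg hl.1, if_neg hl.2.1]
          rw [this, e, e]
          have := hpos _ hBj
          simp only [hj, hjr, hd, hδ0, if_true, if_false, lt_irrefl]
          lia
      · -- Replace an entry by its remainder modulo the smaller one of the two.
        have red : ∀ a b : Fin N, a ≤ r → b ≤ r → a ≠ b → B r b ≠ 0 → δ (B r b) ≤ δ (B r a) →
            ∃ U ∈ elementary (Fin N) R,
              ∀ i j : Fin N, i = r ∨ r < i → j < i → (B * U) i j = 0 := by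
          intro a b ha hb hab hne hle
          obtain ⟨x, hx⟩ := hδ (B r a) (B r b) hne
          refine step (1 + single b a (-x)) (one_add_single_mem_elementary hab.symm _)
            (keep _ _ _ _ hb ha hB) ?_
          rw [← hm]
          refine Finset.sum_lt_sum (fun l _ => ?_) ⟨a, Finset.mem_univ _, ?_⟩
          · refine Nat.mul_le_mul_left _ ?_
            rw [mul_one_add_single_apply]
            split_ifs with h
            · subst h
              rw [mul_neg, ← sub_eq_add_neg]
              exact (hx.trans_le hle).le
            · rw [add_zero]
          · rw [mul_one_add_single_apply, if_pos rfl, mul_neg, ← sub_eq_add_neg]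
            refine Nat.mul_lt_mul_of_pos_left (hx.trans_le hle) ?_
            rcases ha.lt_or_eq with h | h
            · simp [h]
            · simp [h]
        rcases le_total (δ (B r j)) (δ (B r r)) with h | h
        · exact red r j le_rfl hj.le hj.ne' hBj h
        · exact red j r hj.le le_rfl hj.ne hd h

/-- Over a skew field, an upper triangular matrix with non-zero diagonal entries is the product of
elementary matrices and its diagonal part. -/
theorem exists_mem_elementary_mul_eq_diagonal {F : Type*} [DivisionRing F] {N : ℕ}
    (T : Matrix (Fin N) (Fin N) F) (hT : ∀ i j : Fin N, j < i → T i j = 0)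
    (hd : ∀ i, T i i ≠ 0) :
    ∃ W ∈ elementary (Fin N) F, W * T = diagonal fun i => T i i := by
  classical
  -- Induction on the number of non-zero entries off the diagonal.
  let s : Matrix (Fin N) (Fin N) F → Finset (Fin N × Fin N) := fun T =>
    Finset.univ.filter fun p => p.1 ≠ p.2 ∧ T p.1 p.2 ≠ 0
  suffices h : ∀ (m : ℕ) (T : Matrix (Fin N) (Fin N) F), (s T).card = m →
      (∀ i j : Fin N, j < i → T i j = 0) → (∀ i, T i i ≠ 0) →
      ∃ W ∈ elementary (Fin N) F, W * T = diagonal fun i => T i i from h _ T rfl hT hd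
  intro m
  induction m using Nat.strong_induction_on with
  | _ m ih =>
    intro T hm hT hd
    rcases (s T).eq_empty_or_nonempty with h | h
    · refine ⟨1, one_mem _, ?_⟩
      rw [Matrix.one_mul]
      ext i j
      by_cases hij : i = j
      · subst hij; simp
      · rw [diagonal_apply_ne _ hij]
        by_contra hne
        have : (i, j) ∈ s T := by simp [s, hij, hne]
        simp [h] at this
    · -- In the last column `k` with such an entry, row `k` consists of its diagonal entry only.
      obtain ⟨⟨i, k⟩, hik, hmax⟩ := (s T).exists_max_image Prod.snd h
      simp only [s, Finset.mem_filter, Finset.mem_univ, true_and] at hik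
      have hrow : ∀ l, l ≠ k → T k l = 0 := by
        intro l hl
        rcases hl.lt_or_gt with hl | hl
        · exact hT k l hl
        · by_contra hne
          exact absurd (hmax (k, l) (by simp [s, hl.ne, hne])) (not_le.2 hl)
      set E : Matrix (Fin N) (Fin N) F := 1 + single i k (-(T i k * (T k k)⁻¹)) with hE
      have hET : ∀ a b, (E * T) a b = if a = i ∧ b = k then 0 else T a b := by
        intro a b
        rw [hE, one_add_single_mul_apply]
        by_cases ha : a = i
        · subst ha
          by_cases hb : b = k
          · subst hb; simp [hd]
          · simp [hb, hrow b hb]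
        · simp [ha]
      have hsub : s (E * T) ⊂ s T := by
        refine Finset.ssubset_iff_of_subset (fun p hp => ?_) |>.2 ⟨(i, k), ?_, ?_⟩
        · simp only [s, Finset.mem_filter, Finset.mem_univ, true_and, hET] at hp ⊢
          refine ⟨hp.1, fun h => hp.2 ?_⟩
          rw [h, ite_self]
        · simp [s, hik]
        · simp [s, hET]
      have hdiag : ∀ l, (E * T) l l = T l l := by
        intro l
        rw [hET, if_neg]
        rintro ⟨rfl, h⟩
        exact hik.1 h
      obtain ⟨W, hW, h⟩ := ih _ (hm ▸ Finset.card_lt_card hsub) (E * T) rfl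
        (fun a b hab => by rw [hET, hT a b hab, ite_self]) (fun l => by rw [hdiag]; exact hd l)
      refine ⟨W * E, mul_mem hW (one_add_single_mem_elementary hik.1 _), ?_⟩
      rw [Matrix.mul_assoc, h]
      simp only [hdiag]

end Elementary

end Matrix

/-! ### The representation of `ℍ(q)` by matrices of size two -/

namespace SliceRegular

/-- The representation of a quaternion `z + w j`, with `z` and `w` complex, by the matrix
with rows `(z, w)` and `(-w̄, z̄)`. -/
def quaternionMatrix : ℍ[ℝ] →+* Matrix (Fin 2) (Fin 2) ℂ where
  toFun a := !![⟨a.re, a.imI⟩, ⟨a.imJ, a.imK⟩; ⟨-a.imJ, a.imK⟩, ⟨a.re, -a.imI⟩]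
  map_one' := by
    ext i j; fin_cases i <;> fin_cases j <;> simp [Complex.ext_iff]
  map_mul' a b := by
    ext i j; fin_cases i <;> fin_cases j <;> simp [Complex.ext_iff] <;> constructor <;> ring
  map_zero' := by
    ext i j; fin_cases i <;> fin_cases j <;> simp [Complex.ext_iff]
  map_add' a b := by
    ext i j; fin_cases i <;> fin_cases j <;> simp [Complex.ext_iff] <;> ring

/-- The coefficientwise extension of `quaternionMatrix` to polynomials. -/
def polyMatrix : Poly1 →+* Matrix (Fin 2) (Fin 2) ℂ[X] :=
  (matPolyEquiv (R := ℂ) (n := Fin 2)).symm.toRingEquiv.toRingHom.comp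
    (mapRingHom quaternionMatrix)

theorem coeff_polyMatrix (p : Poly1) (i j : Fin 2) (k : ℕ) :
    (polyMatrix p i j).coeff k = quaternionMatrix (p.coeff k) i j := by
  change (matPolyEquiv.symm (p.map quaternionMatrix) i j).coeff k = _
  rw [matPolyEquiv_symm_apply_coeff, coeff_map]

theorem polyMatrix_injective : Function.Injective polyMatrix := by
  intro p q h
  ext1 k
  have h0 := coeff_polyMatrix p 0 0 k
  have h1 := coeff_polyMatrix p 0 1 k
  rw [h, coeff_polyMatrix] at h0 h1
  simp [quaternionMatrix] at h0 h1
  exact Quaternion.ext_iff.2 ⟨h0.1.symm, h0.2.symm, h1.1.symm, h1.2.symm⟩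

theorem polyMatrix_conj (p : Poly1) : polyMatrix (conj p) = (polyMatrix p).adjugate := by
  rw [Matrix.adjugate_fin_two]
  ext i j k
  rw [coeff_polyMatrix, coeff_conj]
  fin_cases i <;> fin_cases j <;>
    simp [coeff_polyMatrix, quaternionMatrix, Complex.ext_iff]

theorem polyMatrix_mul_conj (p : Poly1) :
    polyMatrix (p * conj p) = (polyMatrix p).det • 1 := by
  rw [map_mul, polyMatrix_conj, Matrix.mul_adjugate]

theorem det_polyMatrix_ne_zero {p : Poly1} (hp : p ≠ 0) : (polyMatrix p).det ≠ 0 := by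
  intro h
  have := polyMatrix_mul_conj p
  rw [h, zero_smul, map_eq_zero_iff _ polyMatrix_injective] at this
  exact mul_ne_zero hp (conj_ne_zero hp) this

/-- The polynomials of `ℍ[q]` with the same reduced norm have the same symmetrization. -/
theorem mul_conj_eq_of_det_eq {p s : Poly1} (h : (polyMatrix p).det = (polyMatrix s).det) :
    p * conj p = s * conj s :=
  polyMatrix_injective <| by rw [polyMatrix_mul_conj, polyMatrix_mul_conj, h]

/-- `polyMatrix` with entries in the field of rational functions. -/
def fracMatrix : Poly1 →+* Matrix (Fin 2) (Fin 2) (FractionRing ℂ[X]) :=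
  (algebraMap ℂ[X] (FractionRing ℂ[X])).mapMatrix.comp polyMatrix

theorem det_fracMatrix (p : Poly1) :
    (fracMatrix p).det = algebraMap ℂ[X] (FractionRing ℂ[X]) (polyMatrix p).det :=
  ((algebraMap ℂ[X] (FractionRing ℂ[X])).map_det (polyMatrix p)).symm

theorem isUnit_fracMatrix {p : Poly1} (hp : p ≠ 0) : IsUnit (fracMatrix p) := by
  rw [Matrix.isUnit_iff_isUnit_det, det_fracMatrix, isUnit_iff_ne_zero]
  simpa using det_polyMatrix_ne_zero hp

/-- The units of the matrix ring over the rational functions given by the denominators. -/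
def fracMatrixUnit : Poly1⁰ →* (Matrix (Fin 2) (Fin 2) (FractionRing ℂ[X]))ˣ where
  toFun s := (isUnit_fracMatrix (nonZeroDivisors.ne_zero s.2)).unit
  map_one' := Units.ext (map_one fracMatrix)
  map_mul' s t := Units.ext (map_mul fracMatrix s.1 t.1)

/-- The representation of the skew field `ℍ(q)` by matrices of size two over a commutative field,
namely the rational functions with complex coefficients. -/
def quotMatrix : QuotField →+* Matrix (Fin 2) (Fin 2) (FractionRing ℂ[X]) :=
  OreLocalization.universalHom fracMatrix fracMatrixUnit fun _ => rfl

theorem quotMatrix_toQuot (p : Poly1) : quotMatrix (toQuot p) = fracMatrix p :=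
  OreLocalization.universalHom_commutes fracMatrix fracMatrixUnit fun _ => rfl

theorem toQuot_injective : Function.Injective toQuot :=
  OreLocalization.numeratorHom_inj fun _ h => h.1

theorem toQuot_eq_zero {p : Poly1} : toQuot p = 0 ↔ p = 0 :=
  map_eq_zero_iff _ toQuot_injective

theorem exists_toQuot_mul_eq (x : QuotField) :
    ∃ s p : Poly1, s ≠ 0 ∧ toQuot s * x = toQuot p := by
  induction x using OreLocalization.ind with
  | _ p s =>
    refine ⟨s, p, nonZeroDivisors.ne_zero s.2, ?_⟩
    change OreLocalization.numeratorHom (s : Poly1) * (p /ₒ s) = OreLocalization.numeratorHom p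
    rw [OreLocalization.numeratorHom_apply, OreLocalization.numeratorHom_apply]
    have := OreLocalization.oreDiv_mul_char (s : Poly1) p (1 : Poly1⁰) s 1 1 (by simp)
    rw [this]; simp

/-! ### Conjugation and central denominators -/

/-- Every element of `ℍ(q)` is a fraction with central denominator. -/
theorem exists_central_toQuot_mul_eq (x : QuotField) :
    ∃ c r : Poly1, c ≠ 0 ∧ conj c = c ∧ (∀ g, c * g = g * c) ∧ toQuot c * x = toQuot r := by
  obtain ⟨s, p, hs, h⟩ := exists_toQuot_mul_eq x
  refine ⟨conj s * s, conj s * p, mul_ne_zero (conj_ne_zero hs) hs, ?_, conj_mul_self_comm s, ?_⟩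
  · rw [conj_mul, conj_conj]
  · rw [map_mul, mul_assoc, h, map_mul]

theorem conj_add (f g : Poly1) : conj (f + g) = conj f + conj g := by
  simp [conj]

theorem star_eq_of_central (a : ℍ[ℝ]) (h : ∀ b, a * b = b * a) : star a = a := by
  have h' : ∀ b, _ := fun b => Quaternion.ext_iff.1 (h b)
  simp only [Quaternion.re_mul, Quaternion.imI_mul, Quaternion.imJ_mul, Quaternion.imK_mul] at h'
  have hi := h' ⟨0, 1, 0, 0⟩
  have hj := h' ⟨0, 0, 1, 0⟩
  simp at hi hj
  ext
  · simp
  · simp; linarith [hj.2]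
  · simp; linarith [hi.2]
  · simp; linarith [hj.1]

/-- A polynomial `p` is similar to its conjugate. Unless `p` is central, a commutator `p w - w p`
intertwines the two, because `p` and `conj p` have a central sum and a central product. -/
theorem exists_conj_mul_eq (p : Poly1) : ∃ u : Poly1, u ≠ 0 ∧ conj p * u = u * p := by
  by_cases h : ∀ w, p * w = w * p
  · have hc : conj p = p := by
      ext1 n
      rw [coeff_conj]
      exact star_eq_of_central _ fun a => by rw [← coeff_mul_C, ← coeff_C_mul, h]
    exact ⟨1, one_ne_zero, by rw [hc, mul_one, one_mul]⟩
  · push Not at h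
    obtain ⟨w, hw⟩ := h
    refine ⟨p * w - w * p, sub_ne_zero.2 hw, ?_⟩
    -- The trace `p + conj p` is central, as a combination of the norms of `1`, `p` and `1 + p`.
    have ht : ∀ g, (p + conj p) * g = g * (p + conj p) := by
      have := conj_mul_self_comm (1 + p)
      have h1 : conj (1 : Poly1) = 1 := by simp [conj]
      intro g
      have h2 := this g
      have h3 := conj_mul_self_comm p g
      rw [conj_add, h1] at h2
      have e : (1 + conj p) * (1 + p) = 1 + (p + conj p) + conj p * p := by noncomm_ring
      rw [e, add_mul, mul_add, h3] at h2
      have h4 := add_right_cancel h2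
      rw [add_mul, mul_add, one_mul, mul_one] at h4
      exact add_left_cancel h4
    have e1 : conj p * (p * w - w * p) - (p * w - w * p) * p
        = (conj p * p * w - w * (conj p * p)) - ((p + conj p) * w - w * (p + conj p)) * p := by
      noncomm_ring
    rw [← sub_eq_zero, e1, ht, conj_mul_self_comm]
    simp

/-! ### The reduced norm on `ℍ(q)` -/

/-- The reduced norm on the multiplicative group of `ℍ(q)`. -/
def redNorm : QuotFieldˣ →* (FractionRing ℂ[X])ˣ :=
  Units.map (Matrix.detMonoidHom.comp quotMatrix.toMonoidHom)

theorem of_eq_of_mul_eq {x y z w : QuotFieldˣ} (h : (x : QuotField) * z = w * y) :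
    (Abelianization.of x * Abelianization.of z : Abelianization QuotFieldˣ)
      = Abelianization.of w * Abelianization.of y := by
  rw [← map_mul, ← map_mul]
  exact congrArg _ (Units.ext h)

/-- An element of `ℍ(q)` of reduced norm `1` is a product of commutators: as in Hilbert's
Theorem 90, `x ≠ -1` is the quotient of `1 + x` by its conjugate, and these two are similar. -/
theorem of_eq_one_of_redNorm_eq_one {x : QuotFieldˣ} (hx : redNorm x = 1) :
    Abelianization.of x = 1 := by
  obtain ⟨c, r, hc, hcc, hcomm, hcr⟩ := exists_central_toQuot_mul_eq (x : QuotField)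
  have hcr' : toQuot c ≠ 0 := toQuot_eq_zero.not.2 hc
  -- Similar non-zero polynomials have the same class.
  have sim : ∀ p q u : Poly1, ∀ (hp : toQuot p ≠ 0) (hq : toQuot q ≠ 0), u ≠ 0 → p * u = u * q →
      Abelianization.of (Units.mk0 _ hp) = Abelianization.of (Units.mk0 _ hq) := by
    intro p q u hp hq hu h
    have := of_eq_of_mul_eq (x := Units.mk0 _ hp) (y := Units.mk0 _ hq)
      (z := Units.mk0 _ (toQuot_eq_zero.not.2 hu)) (w := Units.mk0 _ (toQuot_eq_zero.not.2 hu))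
      (by simp only [Units.val_mk0, ← map_mul, h])
    rw [mul_comm] at this
    exact mul_left_cancel this
  by_cases hy : c + r = 0
  · -- Here `x = -1`, and the quaternion units satisfy `j * i = i * (-j)`.
    obtain ⟨i, j, hi, hj, hij⟩ : ∃ i j : ℍ[ℝ], i ≠ 0 ∧ j ≠ 0 ∧ j * i = i * -j := by
      obtain ⟨i, hi⟩ : ∃ i : ℍ[ℝ], i.re = 0 ∧ i.imI = 1 ∧ i.imJ = 0 ∧ i.imK = 0 :=
        ⟨⟨0, 1, 0, 0⟩, rfl, rfl, rfl, rfl⟩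
      obtain ⟨j, hj⟩ : ∃ j : ℍ[ℝ], j.re = 0 ∧ j.imI = 0 ∧ j.imJ = 1 ∧ j.imK = 0 :=
        ⟨⟨0, 0, 1, 0⟩, rfl, rfl, rfl, rfl⟩
      refine ⟨i, j, ?_, ?_, ?_⟩
      · rintro rfl; simp at hi
      · rintro rfl; simp at hj
      · apply Quaternion.ext <;> simp [hi, hj]
    have hCj : toQuot (C j) ≠ 0 := toQuot_eq_zero.not.2 (C_ne_zero.2 hj)
    have hCj' : toQuot (C (-j)) ≠ 0 := toQuot_eq_zero.not.2 (C_ne_zero.2 (neg_ne_zero.2 hj))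
    have h2 := sim (C j) (C (-j)) (C i) hCj hCj' (C_ne_zero.2 hi) (by rw [← C_mul, ← C_mul, hij])
    have h3 := of_eq_of_mul_eq (x := x) (z := Units.mk0 _ hCj) (w := 1)
      (y := Units.mk0 _ hCj') (by
        refine mul_left_cancel₀ hcr' ?_
        rw [Units.val_mk0, Units.val_one, Units.val_mk0, one_mul, ← mul_assoc, hcr, ← map_mul,
          ← map_mul, eq_neg_of_add_eq_zero_right hy, C_neg, neg_mul, mul_neg])
    rw [h2, map_one] at h3
    exact mul_right_cancel h3
  · have hdet : (polyMatrix r).det = (polyMatrix c).det := by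
      have h1 : (quotMatrix x).det = 1 := congrArg Units.val hx
      have h2 := congrArg (fun y => (quotMatrix y).det) hcr
      simp only [map_mul, Matrix.det_mul, h1, mul_one, quotMatrix_toQuot, det_fracMatrix] at h2
      exact (IsFractionRing.injective ℂ[X] (FractionRing ℂ[X]) h2).symm
    have hnorm := mul_conj_eq_of_det_eq hdet
    have hyc := conj_ne_zero hy
    obtain ⟨u, hu, hsim⟩ := exists_conj_mul_eq (c + r)
    have h1 := sim _ _ u (toQuot_eq_zero.not.2 hyc) (toQuot_eq_zero.not.2 hy) hu hsim
    have h2 : (x : QuotField) * toQuot (conj (c + r)) = toQuot (c + r) := by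
      refine mul_left_cancel₀ hcr' ?_
      rw [← mul_assoc, hcr, ← map_mul, ← map_mul, conj_add, mul_add, mul_add, hnorm, hcc, hcomm r,
        add_comm]
    have h3 := of_eq_of_mul_eq (x := x) (z := Units.mk0 _ (toQuot_eq_zero.not.2 hyc)) (w := 1)
      (y := Units.mk0 _ (toQuot_eq_zero.not.2 hy)) (by
        rw [Units.val_mk0, Units.val_one, Units.val_mk0, h2, one_mul])
    rw [h1, map_one] at h3
    exact mul_right_cancel h3

/-- The reduced norm on the abelianization of the multiplicative group. -/
def redNormAb : Abelianization QuotFieldˣ →* (FractionRing ℂ[X])ˣ :=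
  Abelianization.lift redNorm

theorem redNormAb_injective : Function.Injective redNormAb := by
  rw [injective_iff_map_eq_one]
  intro a ha
  obtain ⟨x, rfl⟩ := QuotientGroup.mk_surjective a
  exact of_eq_one_of_redNorm_eq_one ha

/-! ### The reduced norm of matrices and the Dieudonné determinant -/

/-- The reduced norm of a square matrix over `ℍ(q)`: the determinant of the matrix of blocks of
size two that represent its entries. -/
def matrixNorm (N : ℕ) : Matrix (Fin N) (Fin N) QuotField →* FractionRing ℂ[X] :=
  Matrix.detMonoidHom.comp
    ((Matrix.compRingEquiv (Fin N) (Fin 2) (FractionRing ℂ[X])).toRingHom.comp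
      quotMatrix.mapMatrix).toMonoidHom

theorem matrixNorm_of_upperTriangular {N : ℕ} (T : Matrix (Fin N) (Fin N) QuotField)
    (hT : ∀ i j : Fin N, j < i → T i j = 0) :
    matrixNorm N T = ∏ i, (quotMatrix (T i i)).det := by
  have hB : (Matrix.comp _ _ _ _ _ (T.map quotMatrix)).BlockTriangular Prod.fst := by
    rintro ⟨i, k⟩ ⟨j, l⟩ h
    simp [Matrix.comp_apply, hT i j h]
  change (Matrix.comp _ _ _ _ _ (T.map quotMatrix)).det = _
  rw [hB.det_fintype]
  refine Finset.prod_congr rfl fun i _ => ?_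
  let e : Fin 2 ≃ {p : Fin N × Fin 2 // p.1 = i} :=
    ⟨fun l => ⟨(i, l), rfl⟩, fun p => p.1.2, fun _ => rfl, by rintro ⟨⟨_, _⟩, rfl⟩; rfl⟩
  rw [← Matrix.det_submatrix_equiv_self e]
  rfl

theorem ne_zero_of_isUnit_of_upperTriangular {N : ℕ} {T : Matrix (Fin N) (Fin N) QuotField}
    (hT : ∀ i j : Fin N, j < i → T i j = 0) (hu : IsUnit T) (i : Fin N) : T i i ≠ 0 := by
  intro h
  have h1 := (hu.map (matrixNorm N)).ne_zero
  rw [matrixNorm_of_upperTriangular T hT] at h1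
  refine h1 (Finset.prod_eq_zero (Finset.mem_univ i) ?_)
  rw [h, map_zero, Matrix.det_zero]

/-- The reduced norm on the general linear group of `ℍ(q)`. -/
def glNorm (N : ℕ) : GL (Fin N) QuotField →* (FractionRing ℂ[X])ˣ := Units.map (matrixNorm N)

theorem glNorm_eq_of_upperTriangular {N : ℕ} (u : GL (Fin N) QuotField) (d : Fin N → QuotFieldˣ)
    (hT : ∀ i j : Fin N, j < i → (u : Matrix _ _ QuotField) i j = 0)
    (hd : ∀ i, (u : Matrix _ _ QuotField) i i = d i) :
    glNorm N u = redNormAb (Abelianization.of (List.ofFn d).prod) := by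
  change _ = redNorm _
  rw [map_list_prod, List.map_ofFn, List.prod_ofFn]
  ext
  change matrixNorm N u = _
  rw [matrixNorm_of_upperTriangular _ hT, Units.coe_prod]
  exact Finset.prod_congr rfl fun i _ => by rw [hd]; rfl

theorem toQuot_X_ne_zero : toQuot X ≠ 0 := toQuot_eq_zero.not.2 X_ne_zero

theorem toQuot_X_ne_one : toQuot X ≠ 1 := fun h =>
  X_ne_C 1 ((toQuot_injective (h.trans (map_one _).symm)).trans C_1.symm)

/-- Reduced norms of invertible matrices are reduced norms of elements. -/
theorem glNorm_mem_range {N : ℕ} (u : GL (Fin N) QuotField) :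
    glNorm N u ∈ redNormAb.range := by
  classical
  obtain ⟨U, hU, hT⟩ := Matrix.exists_mul_mem_elementary_upperTriangular
    (fun x : QuotField => if x = 0 then 0 else 1) (by simp)
    (fun a b hb => ⟨b⁻¹ * a, by simp [hb]⟩) (u : Matrix (Fin N) (Fin N) QuotField)
  obtain ⟨v, rfl⟩ := Matrix.isUnit_of_mem_elementary hU
  have hd := ne_zero_of_isUnit_of_upperTriangular hT (u * v).isUnit
  have h1 := Matrix.hom_eq_one_of_mem_elementary toQuot_X_ne_zero toQuot_X_ne_one (glNorm N) hU
  have h2 := glNorm_eq_of_upperTriangular (u * v) (fun i => Units.mk0 _ (hd i)) hT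
    fun i => rfl
  rw [map_mul, h1, mul_one] at h2
  exact ⟨_, h2.symm⟩

/-- The Dieudonné determinant over `ℍ(q)` exists: the reduced norm identifies its target with a
group of non-zero rational functions. -/
theorem isDet_detGL (N : ℕ) : Dieudonne.IsDet (Dieudonne.detGL N QuotField) := by
  refine Classical.epsilon_spec (p := Dieudonne.IsDet (F := QuotField) (n := N)) ?_
  let e := MonoidHom.ofInjective redNormAb_injective
  refine ⟨(e.symm : _ →* _).comp ((glNorm N).codRestrict redNormAb.range glNorm_mem_range), ?_⟩
  intro u d hu
  change e.symm _ = _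
  rw [MulEquiv.symm_apply_eq]
  refine Subtype.ext ?_
  change glNorm N u = redNormAb _
  refine glNorm_eq_of_upperTriangular u d (fun i j h => ?_) fun i => ?_
  · rw [hu, Matrix.diagonal_apply_ne _ h.ne']
  · rw [hu, Matrix.diagonal_apply_eq]

/-! ### Determinants of matrices over `ℍ[q]` -/

theorem det_map_toQuot_of_upperTriangular {N : ℕ} (A U : Matrix (Fin N) (Fin N) Poly1)
    (hU : U ∈ Matrix.elementary (Fin N) Poly1) (hT : ∀ i j : Fin N, j < i → (A * U) i j = 0) :
    Dieudonne.det (A.map toQuot)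
      = Dieudonne.cls (toQuot (List.ofFn fun i => (A * U) i i).prod) := by
  have hT' : ∀ i j : Fin N, j < i → ((A * U).map toQuot) i j = 0 := fun i j h => by
    rw [Matrix.map_apply, hT i j h, map_zero]
  have hU' := Matrix.map_mem_elementary toQuot hU
  have hAU : A.map toQuot * U.map toQuot = (A * U).map toQuot := Matrix.map_mul.symm
  have hUu := Matrix.isUnit_of_mem_elementary hU'
  by_cases h0 : ∃ i, (A * U) i i = 0
  · obtain ⟨i, hi⟩ := h0
    have hz : (List.ofFn fun i => (A * U) i i).prod = 0 :=
      List.prod_eq_zero (List.mem_ofFn.2 ⟨i, hi⟩)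
    have hn : ¬ IsUnit (A.map toQuot) := fun h =>
      ne_zero_of_isUnit_of_upperTriangular hT' (hAU ▸ h.mul hUu) i
        (by rw [Matrix.map_apply, hi, map_zero])
    rw [hz, map_zero, Dieudonne.det, dif_neg hn, Dieudonne.cls, dif_pos rfl]
  · push Not at h0
    let d : Fin N → QuotFieldˣ := fun i => Units.mk0 _ (toQuot_eq_zero.not.2 (h0 i))
    obtain ⟨W, hW, hD⟩ := Matrix.exists_mem_elementary_mul_eq_diagonal _ hT' fun i =>
      toQuot_eq_zero.not.2 (h0 i)
    obtain ⟨w, rfl⟩ := Matrix.isUnit_of_mem_elementary hW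
    obtain ⟨v, hv⟩ := hUu
    have hDu : IsUnit (Matrix.diagonal fun i => (d i : QuotField)) :=
      ⟨⟨Matrix.diagonal fun i => (d i : QuotField), Matrix.diagonal fun i => ((d i)⁻¹ : QuotFieldˣ),
        by simp [Matrix.diagonal_mul_diagonal], by simp [Matrix.diagonal_mul_diagonal]⟩, rfl⟩
    obtain ⟨D, hDD⟩ := hDu
    have hA : A.map toQuot = ↑(w⁻¹ * D * v⁻¹) := by
      have h1 : (w : Matrix (Fin N) (Fin N) QuotField) * (A.map toQuot * v) = D := by
        rw [hv, hAU, hD, hDD]; rfl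
      rw [Units.val_mul, Units.val_mul, ← h1, Units.inv_mul_cancel_left, Units.mul_inv_cancel_right]
    have hAu : IsUnit (A.map toQuot) := hA ▸ Units.isUnit _
    have hval : hAu.unit = w⁻¹ * D * v⁻¹ := Units.ext hA
    have hw := Matrix.hom_eq_one_of_mem_elementary toQuot_X_ne_zero toQuot_X_ne_one
      (Dieudonne.detGL N QuotField) hW
    have hv' := Matrix.hom_eq_one_of_mem_elementary toQuot_X_ne_zero toQuot_X_ne_one
      (Dieudonne.detGL N QuotField) (u := v) (hv ▸ hU')
    have hp : toQuot (List.ofFn fun i => (A * U) i i).prod = ((List.ofFn d).prod : QuotFieldˣ) := by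
      rw [← Units.coeHom_apply, map_list_prod, map_list_prod, List.map_ofFn, List.map_ofFn]
      rfl
    have hne : toQuot (List.ofFn fun i => (A * U) i i).prod ≠ 0 := hp ▸ Units.ne_zero _
    rw [Dieudonne.det, dif_pos hAu, Dieudonne.cls, dif_neg hne, hval, map_mul, map_mul, map_inv,
      map_inv, hw, hv', inv_one, one_mul, mul_one, isDet_detGL N D d hDD]
    congr 2
    exact Units.ext hp.symm

open Classical in
/-- Division with remainder in `ℍ[q]`, with the quotient on the right of the divisor. -/
theorem exists_natDegree_sub_mul_lt (a b : Poly1) (hb : b ≠ 0) :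
    ∃ x, (if a - b * x = 0 then 0 else (a - b * x).natDegree + 1)
      < if b = 0 then 0 else b.natDegree + 1 := by
  have hl : b.leadingCoeff ≠ 0 := leadingCoeff_ne_zero.2 hb
  have hm : (b * C b.leadingCoeff⁻¹).Monic := monic_mul_leadingCoeff_inv hb
  refine ⟨C b.leadingCoeff⁻¹ * (a /ₘ (b * C b.leadingCoeff⁻¹)), ?_⟩
  have h1 : a - b * (C b.leadingCoeff⁻¹ * (a /ₘ (b * C b.leadingCoeff⁻¹)))
      = a %ₘ (b * C b.leadingCoeff⁻¹) := by
    rw [← mul_assoc, sub_eq_iff_eq_add, modByMonic_add_div]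
  rw [h1, if_neg hb]
  split_ifs with h
  · exact Nat.succ_pos _
  · have h2 := degree_modByMonic_lt a hm
    have h3 : (b * C b.leadingCoeff⁻¹).natDegree = b.natDegree := by
      rw [natDegree_mul_C (inv_ne_zero hl)]
    have := natDegree_lt_natDegree h h2
    lia

/-- The Dieudonné determinant of a non-empty square matrix over `ℍ[q]` is represented by a
polynomial `R` such that the vector `(R, 0, …, 0)` lies in the right span of the columns: if
column operations make the matrix upper triangular, `R` is the product of the diagonal entries,
a right multiple of the only non-zero entry of the first column. -/
theorem exists_det_eq_and_mulVec_eq {N : ℕ} (hN : 0 < N) (A : Matrix (Fin N) (Fin N) Poly1) :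
    ∃ R : Poly1, Dieudonne.det (A.map toQuot) = Dieudonne.cls (toQuot R) ∧
      ∃ v : Fin N → Poly1, A.mulVec v = Pi.single ⟨0, hN⟩ R := by
  classical
  obtain ⟨U, hU, hT⟩ := Matrix.exists_mul_mem_elementary_upperTriangular
    (fun p : Poly1 => if p = 0 then 0 else p.natDegree + 1) (by simp)
    exists_natDegree_sub_mul_lt A
  refine ⟨_, det_map_toQuot_of_upperTriangular A U hU hT, ?_⟩
  obtain _ | n := N
  · exact absurd hN (lt_irrefl 0)
  · refine ⟨U.mulVec (Pi.single 0 (List.ofFn fun i : Fin n => (A * U) i.succ i.succ).prod), ?_⟩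
    rw [Matrix.mulVec_mulVec]
    ext1 i
    rw [Matrix.mulVec, dotProduct, Finset.sum_eq_single 0 (fun j _ hj => by simp [hj]) (by simp),
      Pi.single_eq_same, List.ofFn_succ, List.prod_cons]
    refine Fin.cases ?_ (fun i => ?_) i
    · exact (Pi.single_eq_same (M := fun _ => Poly1) _ _).symm
    · rw [hT _ _ i.succ_pos, zero_mul]
      exact (Pi.single_eq_of_ne (M := fun _ => Poly1) i.succ_ne_zero _).symm

/-! ### Sylvester matrices and the right ideal -/

/-- The columns of the Sylvester matrix are the coefficient vectors of the products of the two
polynomials by powers of the variable. -/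
theorem exists_sylvester_col_eq (P Q : Poly2) (j : Fin (Q.natDegree + P.natDegree)) :
    ∃ T ∈ rightIdeal P Q, ∑ i : Fin (Q.natDegree + P.natDegree),
      X ^ (i : ℕ) * C (sylvester Q P Q.natDegree P.natDegree i j) = T := by
  have key : ∀ (p : Poly2) (k N : ℕ), k + p.natDegree < N →
      ∑ i : Fin N, X ^ (i : ℕ) *
        C (if (i : ℕ) ∈ Set.Icc k (k + p.natDegree) then p.coeff (i - k) else 0) = p * X ^ k := by
    intro p k N h
    ext1 m
    rw [finsetSum_coeff]
    simp only [coeff_mul_C, coeff_X_pow, ite_mul, one_mul, zero_mul, coeff_mul_X_pow', Set.mem_Icc]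
    by_cases hm : m < N
    · rw [Finset.sum_eq_single ⟨m, hm⟩ (fun i _ hi => if_neg fun h => hi (Fin.ext h.symm)) (by simp)]
      simp only [if_true]
      by_cases hk : k ≤ m
      · by_cases hk' : m ≤ k + p.natDegree
        · simp [hk, hk']
        · rw [if_neg (fun h => hk' h.2), if_pos hk, coeff_eq_zero_of_natDegree_lt (by lia)]
      · simp [hk]
    · rw [Finset.sum_eq_zero fun i _ => if_neg (by lia)]
      split_ifs
      · rw [coeff_eq_zero_of_natDegree_lt (by lia)]
      · rfl
  induction j using Fin.addCases with
  | left j =>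
    refine ⟨P * X ^ (j : ℕ), ⟨X ^ (j : ℕ), 0, by simp⟩, ?_⟩
    simp only [sylvester, Matrix.of_apply, Fin.addCases_left]
    exact key P j (Q.natDegree + P.natDegree) (by lia)
  | right j =>
    refine ⟨Q * X ^ (j : ℕ), ⟨0, X ^ (j : ℕ), by simp⟩, ?_⟩
    simp only [sylvester, Matrix.of_apply, Fin.addCases_right]
    exact key Q j (Q.natDegree + P.natDegree) (by lia)

/-- The column span of the Sylvester matrix lies in the right ideal `⟨P, Q⟩`, the vector
`(R, 0, …, 0)` being the constant polynomial `R` in the outer variable. -/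
theorem exists_det_sylvester_eq (P Q : Poly2) (h : 0 < P.natDegree + Q.natDegree) :
    ∃ R : Poly1,
      Dieudonne.det ((sylvester Q P Q.natDegree P.natDegree).map toQuot)
        = Dieudonne.cls (toQuot R) ∧ C R ∈ rightIdeal P Q := by
  obtain ⟨R, hR, v, hv⟩ :=
    exists_det_eq_and_mulVec_eq (by rwa [add_comm]) (sylvester Q P Q.natDegree P.natDegree)
  refine ⟨R, hR, ?_⟩
  choose T hT hcol using exists_sylvester_col_eq P Q
  choose F G hFG using hT
  have h1 : ∑ i : Fin (Q.natDegree + P.natDegree),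
      X ^ (i : ℕ) * C ((sylvester Q P Q.natDegree P.natDegree).mulVec v i) = C R := by
    rw [hv, Finset.sum_eq_single ⟨0, by rwa [add_comm]⟩
      (fun i _ hi => by rw [Pi.single_eq_of_ne hi, C_0, mul_zero]) (by simp)]
    simp
  refine ⟨∑ j, F j * C (v j), ∑ j, G j * C (v j), ?_⟩
  rw [← h1, Finset.mul_sum, Finset.mul_sum, ← Finset.sum_add_distrib]
  simp only [Matrix.mulVec, dotProduct, map_sum, C_mul, Finset.mul_sum]
  rw [Finset.sum_comm]
  refine Finset.sum_congr rfl fun j _ => ?_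
  rw [← mul_assoc, ← mul_assoc, ← add_mul, ← hFG, ← hcol, Finset.sum_mul]
  exact Finset.sum_congr rfl fun i _ => (mul_assoc _ _ _).symm

/-! ### Exchange of the variables -/

theorem swap_swap (P : Poly2) : swap (swap P) = P := by
  ext1 n; ext1 m
  rw [coeff_coeff_swap, coeff_coeff_swap]

theorem swap_add (P Q : Poly2) : swap (P + Q) = swap P + swap Q := by
  ext1 n; ext1 m
  simp only [coeff_add, coeff_coeff_swap]

theorem swap_mul (P Q : Poly2) : swap (P * Q) = swap P * swap Q := by
  ext1 m; ext1 n
  rw [coeff_coeff_swap, coeff_mul, coeff_mul, finsetSum_coeff, finsetSum_coeff]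
  simp only [coeff_mul, coeff_coeff_swap]
  exact Finset.sum_comm

theorem swap_C (R : Poly1) : swap (C R) = ofQ1 R := by
  ext1 n; ext1 m
  rw [coeff_coeff_swap]
  change _ = ((R.map C).coeff n).coeff m
  rw [coeff_map, coeff_C, coeff_C]
  split_ifs <;> simp

end SliceRegular

end

theorem theorem4p4 (P Q : SliceRegular.Poly2) :
    (0 < SliceRegular.degQ1 P + SliceRegular.degQ1 Q →
      ∃ R : SliceRegular.Poly1,
        SliceRegular.resQ1 P Q = Dieudonne.cls (SliceRegular.toQuot R) ∧
          SliceRegular.ofQ2 R ∈ SliceRegular.rightIdeal P Q) ∧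
    (0 < SliceRegular.degQ2 P + SliceRegular.degQ2 Q →
      ∃ R : SliceRegular.Poly1,
        SliceRegular.resQ2 P Q = Dieudonne.cls (SliceRegular.toQuot R) ∧
          SliceRegular.ofQ1 R ∈ SliceRegular.rightIdeal P Q) := by
  refine ⟨SliceRegular.exists_det_sylvester_eq P Q, fun h => ?_⟩
  obtain ⟨R, hR, F, G, hFG⟩ :=
    SliceRegular.exists_det_sylvester_eq (SliceRegular.swap P) (SliceRegular.swap Q) h
  refine ⟨R, hR, SliceRegular.swap F, SliceRegular.swap G, ?_⟩
  rw [← SliceRegular.swap_C, hFG, SliceRegular.swap_add, SliceRegular.swap_mul,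
    SliceRegular.swap_mul, SliceRegular.swap_swap, SliceRegular.swap_swap]
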